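/- Let $\{0,1\}^\infty$ be the space of infinite binary sequences with its product $\sigma$-algebra. For $x=x_1x_2\ldots$ write $x|_1^n=x_1\ldots x_n$; for a probability measure $\mu$ on $\{0,1\}^\infty$ and a finite binary word $u$, let $\mu(u)$ be the measure of the set of all sequences that begin with $u$. All logarithms are to base $2$, $-\log 0=+\infty$, and $\liminf$ and $\limsup$ are taken in $[-\infty,+\infty]$. The lower pointwise dimension of $\mu$ at $x$ is $$\delta_\mu(x)=\liminf_{n\to\infty}\frac{-\log\mu(x|_1^n)}{n}.$$ The p-value of a real-valued statistic $\tau$ on binary words at a word $u$ of length $n$ is $$\pi_\tau(u)=\frac{|\{y\in\{0,1\}^n:\tau(y)\ge\tau(u)\}|}{2^n}.$$ A semimeasure is a function $M\ge 0$ on finite binary words with $M(\text{empty word})\le 1$ and $M(u0)+M(u1)\le M(u)$ for every word $u$. A nonnegative function $f$ on words is lower semicomputable if the set of pairs $(u,r)$, with $r$ a nonnegative rational and $r<f(u)$, is recursively enumerable. A lower semicomputable semimeasure $M$ is universal if for each lower semicomputable semimeasure $\nu$ there is a constant $c>0$ with $M(u)\ge c\,\nu(u)$ for all words $u$. A measure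 $\mu$ is computable if $\mu(u)$ can be computed, uniformly in $u$, to within $2^{-k}$ for each $k$. **Theorem.** Let $\mu$ be a probability measure on $\{0,1\}^\infty$ other than the uniform Bernoulli measure $B(1/2,1/2)$. (i) For $\mu$-almost every $x$, $$\limsup_{n\to\infty}\frac{-\log\pi_\mu(x|_1^n)}{n}\ \ge\ 1-\delta_\mu(x),$$ where $\pi_\mu$ is the p-value of the statistic $\tau(u)=\mu(u)$. (ii) If $\mu$ is computable and $M$ is any universal lower semicomputable semimeasure, then for $\mu$-almost every $x$, $$\limsup_{n\to\infty}\frac{-\log\pi_M(x|_1^n)}{n}\ \ge\ 1-\delta_\mu(x),$$ where $\pi_M$ is the p-value of the statistic $\tau(u)=M(u)$. -/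

import Mathlib

open MeasureTheory Filter
open scoped ENNReal

namespace RandomTest

/-- The word `x₁ … xₙ` consisting of the first `n` letters of the infinite binary sequence `x`. -/
def pre (x : ℕ → Bool) (n : ℕ) : List Bool :=
  List.ofFn fun i : Fin n => x i

/-- The set of infinite binary sequences that begin with the word `u`. In terms of binary
expansions this is the half-open dyadic interval `[0.u, 0.u + 2^(-|u|))`. -/
def wordCylinder (u : List Bool) : Set (ℕ → Bool) :=
  {x | pre x u.length = u}

/-- The probability `μ(u)` that a `μ`-random sequence begins with the word `u`. -/
noncomputable def wordProb (μ : Measure (ℕ → Bool)) (u : List Bool) : ℝ :=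
  μ.real (wordCylinder u)

/-- The Bernoulli measure `B(1/2, 1/2)`: independent fair coin tosses. -/
noncomputable def fairCoin : Measure (ℕ → Bool) :=
  Measure.infinitePi fun _ : ℕ => (PMF.uniformOfFintype Bool).toMeasure

/-- The p-value of a statistic `τ` at the word `u`, `n = |u|`: the proportion of those
`y ∈ {0,1}ⁿ` for which `τ y ≥ τ u`. -/
noncomputable def pValue (τ : List Bool → ℝ) (u : List Bool) : ℝ≥0∞ :=
  ({y : List Bool | y.length = u.length ∧ τ u ≤ τ y}.ncard : ℝ≥0∞) / 2 ^ u.length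

/-- Binary logarithm with values in `[-∞, ∞]`; `log2 0 = -∞`. -/
noncomputable def log2 (t : ℝ≥0∞) : EReal :=
  ENNReal.log t / (Real.log 2 : EReal)

/-- The lower pointwise dimension of `μ` at `x`. -/
noncomputable def lowerPointwiseDim (μ : Measure (ℕ → Bool)) (x : ℕ → Bool) : EReal :=
  liminf (fun n : ℕ => -log2 (μ (wordCylinder (pre x n))) / (n : EReal)) atTop

/-- A measure on sequences is computable if its values on words can be computed, uniformly in the
word, to any precision: a computable function of a word `u` and of `k` outputs a nonnegative
rational number (a numerator `a` and a denominator `b + 1`) within `2^(-k)` of `μ(u)`. -/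
def IsComputableMeasure (μ : Measure (ℕ → Bool)) : Prop :=
  ∃ g : List Bool → ℕ → ℕ × ℕ, Computable₂ g ∧
    ∀ u k, |wordProb μ u - ((g u k).1 : ℝ) / ((g u k).2 + 1)| ≤ (1 / 2 : ℝ) ^ k

/-- A nonnegative function on words is lower semicomputable (enumerable) if the set of all pairs
of a word `u` and a rational number `a / (b + 1) < f u` is recursively enumerable. -/
def LowerSemicomputable (f : List Bool → ℝ) : Prop :=
  REPred fun t : List Bool × ℕ × ℕ => (t.2.1 : ℝ) / (t.2.2 + 1) < f t.1

/-- A (continuous) semimeasure on the binary words. -/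
structure IsSemimeasure (M : List Bool → ℝ) : Prop where
  nonneg : ∀ u, 0 ≤ M u
  root_le : M [] ≤ 1
  split_le : ∀ u, M (u ++ [false]) + M (u ++ [true]) ≤ M u

/-- A universal lower semicomputable semimeasure: a lower semicomputable semimeasure that
dominates, up to a positive multiplicative constant, each lower semicomputable semimeasure. -/
structure IsUniversalSemimeasure (M : List Bool → ℝ) : Prop where
  semimeasure : IsSemimeasure M
  enumerable : LowerSemicomputable M
  dominates : ∀ ν : List Bool → ℝ, IsSemimeasure ν → LowerSemicomputable ν →
    ∃ c : ℝ, 0 < c ∧ ∀ u, c * ν u ≤ M u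

end RandomTest

namespace RandomTest

/-! The values of a semimeasure `M` on words of length `n` sum to at most 1, so at most `1 / M u` of
these words `y` satisfy `M y ≥ M u`; hence the p-value of `u` is at most `2^(-n) / M u` when `M u >
0` (`exists_pValue_eq`). If `M ≥ c μ` with `c > 0`, taking logarithms and dividing by `n` gives
`-log π_M(u) / n ≥ 1 + (log c) / n - (-log μ(u)) / n`, and the limsup turns the last term into minus
the lower dimension. Part (i) is `M = μ`, `c = 1`. In part (ii) universality supplies `c`, because a
computable measure is lower semicomputable. The bound holds at every sequence, not only almost
everywhere. -/

lemma length_pre (x : ℕ → Bool) (n : ℕ) : (pre x n).length = n := by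
  simp [pre]

lemma mem_wordCylinder_append_singleton (x : ℕ → Bool) (u : List Bool) (b : Bool) :
    x ∈ wordCylinder (u ++ [b]) ↔ x ∈ wordCylinder u ∧ x u.length = b := by
  have h : pre x (u.length + 1) = pre x u.length ++ [x u.length] := by
    rw [pre, List.ofFn_succ_last]
    rfl
  simp only [wordCylinder, Set.mem_ofPred_eq, List.length_append, List.length_singleton, h]
  rw [← List.concat_eq_append, ← List.concat_eq_append, List.concat_inj]

/-- The values of a probability measure on cylinders form a semimeasure. -/
lemma isSemimeasure_wordProb (μ : Measure (ℕ → Bool)) [IsProbabilityMeasure μ] :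
    IsSemimeasure (wordProb μ) where
  nonneg _ := measureReal_nonneg
  root_le := measureReal_le_one
  split_le u := by
    have hs : MeasurableSet {x : ℕ → Bool | x u.length = false} :=
      measurableSet_eq_fun (measurable_pi_apply u.length) measurable_const
    have h₀ : wordCylinder (u ++ [false]) = wordCylinder u ∩ {x | x u.length = false} := by
      ext x
      exact mem_wordCylinder_append_singleton x u false
    have h₁ : wordCylinder (u ++ [true]) = wordCylinder u \ {x | x u.length = false} := by
      ext x
      simp [mem_wordCylinder_append_singleton]
    rw [wordProb, wordProb, h₀, h₁, measureReal_inter_add_sdiff hs]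
    rfl

/-- The words of a fixed length have total semimeasure at most one. -/
lemma IsSemimeasure.sum_le_one {M : List Bool → ℝ} (hM : IsSemimeasure M) (n : ℕ) :
    ∀ S : Finset (List Bool), (∀ y ∈ S, y.length = n) → ∑ y ∈ S, M y ≤ 1 := by
  induction n with
  | zero =>
    intro S hS
    have hsub : S ⊆ {[]} := fun y hy => by simpa using hS y hy
    calc ∑ y ∈ S, M y ≤ ∑ y ∈ {[]}, M y :=
          Finset.sum_le_sum_of_subset_of_nonneg hsub fun y _ _ => hM.nonneg y
      _ ≤ 1 := by simpa using hM.root_le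
  | succ n ih =>
    intro S hS
    set T := S.image List.dropLast
    have hT : ∀ w ∈ T, w.length = n := by
      intro w hw
      obtain ⟨y, hy, rfl⟩ := Finset.mem_image.mp hw
      simp [hS y hy]
    -- Adding the missing siblings of words in `S` can only increase the sum, and sibling pairs are
    -- controlled by `split_le`.
    have hsub : S ⊆ T.biUnion fun w => {w ++ [false], w ++ [true]} := by
      intro y hy
      have hne : y ≠ [] := by
        rintro rfl
        simpa using hS _ hy
      refine Finset.mem_biUnion.mpr ⟨y.dropLast, Finset.mem_image_of_mem _ hy, ?_⟩
      have hy' := List.dropLast_append_getLast hne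
      rcases hb : y.getLast hne <;> rw [hb] at hy' <;> simp [hy']
    calc ∑ y ∈ S, M y ≤ ∑ y ∈ T.biUnion fun w => {w ++ [false], w ++ [true]}, M y :=
          Finset.sum_le_sum_of_subset_of_nonneg hsub fun y _ _ => hM.nonneg y
      _ = ∑ w ∈ T, ∑ y ∈ {w ++ [false], w ++ [true]}, M y := by
          refine Finset.sum_biUnion fun w _ w' _ hne => ?_
          simp [Function.onFun, hne.symm]
      _ ≤ ∑ w ∈ T, M w := Finset.sum_le_sum fun w _ => by
          rw [Finset.sum_pair (by simp)]
          exact hM.split_le w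
      _ ≤ 1 := ih T hT

/-- Markov's inequality for the p-value of a semimeasure. -/
lemma IsSemimeasure.exists_pValue_eq {M : List Bool → ℝ} (hM : IsSemimeasure M) (u : List Bool) :
    ∃ p : ℝ, 0 < p ∧ pValue M u = ENNReal.ofReal p ∧ M u * p * 2 ^ u.length ≤ 1 := by
  have hfin : {y : List Bool | y.length = u.length ∧ M u ≤ M y}.Finite :=
    (List.finite_length_eq Bool u.length).subset fun y hy => hy.1
  set S := hfin.toFinset with hS
  have hcard : {y : List Bool | y.length = u.length ∧ M u ≤ M y}.ncard = S.card :=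
    Set.ncard_eq_toFinset_card _ hfin
  -- The word `u` counts towards its own p-value, so the logarithm of the p-value is finite.
  have hpos : 0 < S.card := Finset.card_pos.mpr ⟨u, by simp [hS]⟩
  refine ⟨S.card / 2 ^ u.length, by positivity, ?_, ?_⟩
  · rw [pValue, hcard, ENNReal.ofReal_div_of_pos (by positivity),
      ENNReal.ofReal_pow (by norm_num)]
    simp
  · have h : S.card • M u ≤ ∑ y ∈ S, M y :=
      Finset.card_nsmul_le_sum _ _ _ fun y hy => by simp [hS] at hy; exact hy.2
    have h' := hM.sum_le_one u.length S fun y hy => by simp [hS] at hy; exact hy.1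
    rw [nsmul_eq_mul] at h
    rw [mul_assoc, div_mul_cancel₀ _ (by positivity), mul_comm]
    exact h.trans h'

lemma log2_ofReal {t : ℝ} (ht : 0 < t) : log2 (ENNReal.ofReal t) = (Real.logb 2 t : EReal) := by
  rw [log2, ENNReal.log_ofReal_of_pos ht, ← EReal.coe_div]
  rfl

/-- Logarithm of the Markov bound, per letter, with `M u` replaced by the smaller `c * wordProb μ
u`. The left side is a sum so that superadditivity of limsup applies to it. -/
lemma IsSemimeasure.neg_log2_pValue_ge {M : List Bool → ℝ} (hM : IsSemimeasure M)
    {μ : Measure (ℕ → Bool)} [IsProbabilityMeasure μ] {c : ℝ} (hc : 0 < c) {u : List Bool}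
    (hcM : c * wordProb μ u ≤ M u) (hu : 0 < u.length) :
    -(-log2 (μ (wordCylinder u)) / ((u.length : ℕ) : EReal))
        + ((1 + Real.logb 2 c / u.length : ℝ) : EReal) ≤
      -log2 (pValue M u) / ((u.length : ℕ) : EReal) := by
  obtain ⟨p, hp, hpv, hle⟩ := hM.exists_pValue_eq u
  set n := u.length
  have hn : (0 : ℝ) < n := by exact_mod_cast hu
  have hcoe : ((n : ℕ) : EReal) = ((n : ℝ) : EReal) := rfl
  -- On a null cylinder the left side is `⊥ + real = ⊥`.
  rcases eq_or_ne (μ (wordCylinder u)) 0 with h0 | h0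
  · have hl : log2 (μ (wordCylinder u)) = ⊥ := by
      rw [h0, log2, ENNReal.log_zero]
      exact EReal.bot_div_of_pos_ne_top (by exact_mod_cast Real.log_pos one_lt_two)
        (EReal.coe_ne_top _)
    rw [hl, EReal.neg_bot, hcoe, EReal.top_div_of_pos_ne_top (by exact_mod_cast hn)
      (EReal.coe_ne_top _), EReal.neg_top, EReal.bot_add]
    exact bot_le
  · set m := wordProb μ u
    have hmu : μ (wordCylinder u) = ENNReal.ofReal m := by
      simp [m, wordProb]
    have hm : 0 < m := ENNReal.toReal_pos h0 (measure_ne_top _ _)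
    have key : Real.logb 2 c + Real.logb 2 m + Real.logb 2 p + n ≤ 0 := by
      have h1 : c * m * p * 2 ^ n ≤ 1 := le_trans (by gcongr) hle
      have h2 := Real.logb_le_logb_of_le one_lt_two (by positivity) h1
      rwa [Real.logb_mul (by positivity) (by positivity),
        Real.logb_mul (by positivity) hp.ne', Real.logb_mul hc.ne' hm.ne', Real.logb_one,
        Real.logb_pow, Real.logb_self_eq_one one_lt_two, mul_one] at h2
    rw [hmu, hpv, log2_ofReal hm, log2_ofReal hp, hcoe, ← EReal.coe_neg, ← EReal.coe_neg,
      ← EReal.coe_div, ← EReal.coe_div, ← EReal.coe_neg, ← EReal.coe_add, EReal.coe_le_coe_iff,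
      le_div_iff₀ hn]
    field_simp
    linarith

/-- The p-value of a semimeasure that dominates `μ` exposes the dimension deficit of every
sequence. -/
lemma IsSemimeasure.one_sub_lowerPointwiseDim_le {M : List Bool → ℝ} (hM : IsSemimeasure M)
    {μ : Measure (ℕ → Bool)} [IsProbabilityMeasure μ] {c : ℝ} (hc : 0 < c)
    (hcM : ∀ u, c * wordProb μ u ≤ M u) (x : ℕ → Bool) :
    1 - lowerPointwiseDim μ x ≤
      limsup (fun n : ℕ => -log2 (pValue M (pre x n)) / (n : EReal)) atTop := by
  let f : ℕ → EReal := fun n => -log2 (μ (wordCylinder (pre x n))) / (n : EReal)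
  let v : ℕ → EReal := fun n => ((1 + Real.logb 2 c / n : ℝ) : EReal)
  have hlim : Tendsto v atTop (nhds 1) := by
    have : Tendsto (fun n : ℕ => 1 + Real.logb 2 c / n) atTop (nhds (1 + 0)) :=
      tendsto_const_nhds.add (tendsto_const_div_atTop_nhds_zero_nat _)
    rw [add_zero] at this
    exact (continuous_coe_real_ereal.tendsto 1).comp this
  calc 1 - lowerPointwiseDim μ x = limsup (-f) atTop + liminf v atTop := by
        rw [EReal.limsup_neg, hlim.liminf_eq, add_comm]
        rfl
    _ ≤ limsup (-f + v) atTop := EReal.le_limsup_add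
    _ ≤ _ := by
        refine limsup_le_limsup ?_
        filter_upwards [eventually_gt_atTop 0] with n hn
        have h := hM.neg_log2_pValue_ge hc (hcM (pre x n)) (by rwa [length_pre])
        rwa [length_pre] at h

lemma primrec_two_pow : Primrec fun k : ℕ => 2 ^ k := by
  have h : Primrec fun k : ℕ => (Nat.rec 1 (fun _ r => 2 * r) k : ℕ) :=
    Primrec.nat_rec₁ 1 (Primrec.nat_mul.comp (Primrec.const 2) Primrec.snd).to₂
  refine h.of_eq fun k => ?_
  induction k with
  | zero => rfl
  | succ k ih => rw [pow_succ', ← ih]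

/-- A computable measure is lower semicomputable. -/
lemma IsComputableMeasure.lowerSemicomputable {μ : Measure (ℕ → Bool)}
    (h : IsComputableMeasure μ) : LowerSemicomputable (wordProb μ) := by
  obtain ⟨g, hg, hgμ⟩ := h
  -- `L < R` is the test `a / (b + 1) + 2^(-k) < g u k` with denominators cleared, so that it is
  -- decided in natural numbers. Success at some `k` certifies `a / (b + 1) < μ(u)`, and an
  -- unbounded search over `k` enumerates these pairs.
  let L : (List Bool × ℕ × ℕ) × ℕ → ℕ := fun s =>
    (s.1.2.1 * 2 ^ s.2 + (s.1.2.2 + 1)) * ((g s.1.1 s.2).2 + 1)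
  let R : (List Bool × ℕ × ℕ) × ℕ → ℕ := fun s =>
    (g s.1.1 s.2).1 * ((s.1.2.2 + 1) * 2 ^ s.2)
  have hpow : Computable fun s : (List Bool × ℕ × ℕ) × ℕ => 2 ^ s.2 :=
    primrec_two_pow.to_comp.comp Computable.snd
  have hG : Computable fun s : (List Bool × ℕ × ℕ) × ℕ => g s.1.1 s.2 :=
    hg.comp (Computable.fst.comp Computable.fst) Computable.snd
  have ha : Computable fun s : (List Bool × ℕ × ℕ) × ℕ => s.1.2.1 :=
    Computable.fst.comp (Computable.snd.comp Computable.fst)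
  have hb : Computable fun s : (List Bool × ℕ × ℕ) × ℕ => s.1.2.2 + 1 :=
    Computable.succ.comp (Computable.snd.comp (Computable.snd.comp Computable.fst))
  have hmul := Primrec.nat_mul.to_comp
  have hL : Computable L :=
    hmul.comp (Primrec.nat_add.to_comp.comp (hmul.comp ha hpow) hb)
      (Computable.succ.comp (Computable.snd.comp hG))
  have hR : Computable R := hmul.comp (Computable.fst.comp hG) (hmul.comp hb hpow)
  have hdec : Computable fun s => decide (L s < R s) :=
    Primrec.nat_lt.decide.to_comp.comp hL hR
  have hre : REPred fun t : List Bool × ℕ × ℕ => ∃ k, L (t, k) < R (t, k) := by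
    have hp : Partrec fun t : List Bool × ℕ × ℕ =>
        Nat.rfind fun k => Part.some (decide (L (t, k) < R (t, k))) :=
      Partrec.rfind (Computable.partrec hdec).to₂
    refine hp.dom_re.of_eq fun t => ?_
    constructor
    · rintro ⟨k, hk, -⟩
      exact ⟨k, by simpa using hk⟩
    · rintro ⟨k, hk⟩
      exact Nat.rfind_dom.mpr ⟨k, by simpa using hk, fun _ => trivial⟩
  refine hre.of_eq fun t => ?_
  obtain ⟨u, a, b⟩ := t
  have hiff : ∀ k, L ((u, a, b), k) < R ((u, a, b), k) ↔
      (a : ℝ) / (b + 1) + (1 / 2) ^ k < ((g u k).1 : ℝ) / ((g u k).2 + 1) := by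
    intro k
    have e : (a : ℝ) / (b + 1) + (1 / 2) ^ k = (a * 2 ^ k + (b + 1)) / ((b + 1) * 2 ^ k) := by
      rw [one_div, inv_pow]
      field_simp
    rw [e, div_lt_div_iff₀ (by positivity) (by positivity)]
    simp only [L, R]
    exact_mod_cast Iff.rfl
  simp only [hiff]
  constructor
  · rintro ⟨k, hk⟩
    have := (abs_le.mp (hgμ u k)).1
    linarith
  · intro hlt
    -- Half the gap, since `2^(-k)` is lost twice: as the error of `g` and as the margin in the
    -- test.
    obtain ⟨k, hk⟩ := exists_pow_lt_of_lt_one (half_pos (sub_pos.mpr hlt))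
      (by norm_num : (1 / 2 : ℝ) < 1)
    refine ⟨k, ?_⟩
    have := (abs_le.mp (hgμ u k)).2
    linarith

end RandomTest

theorem theorem1 (μ : Measure (ℕ → Bool)) [IsProbabilityMeasure μ]
    (hμ : μ ≠ RandomTest.fairCoin) :
    (∀ᵐ x ∂μ,
      1 - RandomTest.lowerPointwiseDim μ x ≤
        limsup (fun n : ℕ =>
          -RandomTest.log2 (RandomTest.pValue (RandomTest.wordProb μ) (RandomTest.pre x n))
            / (n : EReal)) atTop) ∧
    (∀ M : List Bool → ℝ, RandomTest.IsUniversalSemimeasure M →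
      RandomTest.IsComputableMeasure μ →
      ∀ᵐ x ∂μ,
        1 - RandomTest.lowerPointwiseDim μ x ≤
          limsup (fun n : ℕ =>
            -RandomTest.log2 (RandomTest.pValue M (RandomTest.pre x n))
              / (n : EReal)) atTop) := by
  refine ⟨ae_of_all μ fun x => ?_, fun M hM hcomp => ae_of_all μ fun x => ?_⟩
  · exact (RandomTest.isSemimeasure_wordProb μ).one_sub_lowerPointwiseDim_le one_pos
      (fun u => (one_mul _).le) x
  · obtain ⟨c, hc, hcM⟩ :=
      hM.dominates _ (RandomTest.isSemimeasure_wordProb μ) hcomp.lowerSemicomputable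
    exact hM.semimeasure.one_sub_lowerPointwiseDim_le hc hcM x
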